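/- A \emph{tree} is a partially ordered set $(T,\le)$ such that for every $x\in T$ the set $\{y\in T: y<x\}$ is well-ordered by $<$. The order type of this set is the height $\operatorname{ht}(x,T)$, and $\operatorname{cf}(x)$ denotes the cofinality of $\operatorname{ht}(x,T)$. The height $\operatorname{ht}(T)$ of $T$ is the least ordinal $\alpha$ such that no element of $T$ has height $\alpha$. The \emph{coarse wedge topology} on $T$ is the topology whose subbase consists of all sets $V_t=\{s\in T: s\ge t\}$ and their complements, where $t$ is minimal or $\operatorname{ht}(t,T)$ is a successor ordinal. For a set $\Gamma$ let $\Sigma(\Gamma)=\{x\in[0,1]^\Gamma: \{\gamma: x(\gamma)\ne 0\}\text{ is countable}\}$. A subset $A$ of a compact Hausdorff space $K$ is a \emph{$\Sigma$-subset} if there are a set $\Gamma$ and a homeomorphic embedding $h:K\to[0,1]^\Gamma$ with $h(A)=h(K)\cap\Sigma(\Gamma)$. A compact Hausdorff space is called \emph{Valdivia} if it has a dense $\Sigma$-subset. A family $\mathcal U$ of subsets of $X$ is \emph{$T_0$-separating} if for any two distinct $x,y\in X$ some $U\in\mathcal U$ contains exactly one of $x,y$. \textbf{Theorem 4.1.}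 Let $T$ be a tree that has only finitely many minimal elements and in which every nonempty chain has a supremum, endowed with the coarse wedge topology. (In particular, $T$ may be any rooted chain complete tree.) Then the following assertions hold. (1) If $\operatorname{ht}(T)\le\omega_1+1$, then $T$ is a Valdivia compact space. Moreover, in this case the set $D=\{t\in T:\operatorname{cf}(t)\le\omega\}$ is dense in $T$, and there is a $T_0$-separating family $\mathcal U$ of clopen subsets of $T$ such that $D=\{x\in T:\{U\in\mathcal U: x\in U\}\text{ is countable}\}$; in particular $\mathcal U$ is point-countable on $D$. (2) If $T$ is a Valdivia compact space, then $\operatorname{ht}(T)<\omega_2+1$. -/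

import Mathlib

open Set Order
open scoped Ordinal Cardinal

universe u

namespace OrderTree

/-- A (set-theoretic) tree: a partially ordered set in which the set of strict predecessors of every
element is well-ordered by `<`. -/
class IsTree (T : Type u) [PartialOrder T] : Prop where
  isWellOrder_Iio : ∀ x : T, IsWellOrder (Iio x) (· < ·)

attribute [instance] IsTree.isWellOrder_Iio

/-- The height `ht(x, T)` of an element: the order type of `{y | y < x}`. -/
noncomputable def nodeHeight {T : Type u} [PartialOrder T] [IsTree T] (x : T) : Ordinal.{u} :=
  Ordinal.type (fun a b : Iio x => a < b)

/-- The `α`-th level of a tree. -/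
def level (T : Type u) [PartialOrder T] [IsTree T] (α : Ordinal.{u}) : Set T :=
  {x | nodeHeight x = α}

/-- The height `ht(T)` of a tree: the least ordinal `α` such that the `α`-th level is empty. -/
noncomputable def treeHeight (T : Type u) [PartialOrder T] [IsTree T] : Ordinal.{u} :=
  sInf {α | level T α = ∅}

/-- Some level is empty, so the least `α` in the definition of `treeHeight` exists. -/
theorem level_treeHeight (T : Type u) [PartialOrder T] [IsTree T] :
    level T (treeHeight T) = ∅ := by
  have hne : {α : Ordinal.{u} | level T α = ∅}.Nonempty := by
    by_contra h
    refine not_surjective_of_ordinal (nodeHeight : T → Ordinal.{u}) fun α => ?_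
    by_contra hα
    refine h ⟨α, eq_empty_iff_forall_notMem.2 fun x hx => hα ⟨x, hx⟩⟩
  exact csInf_mem hne

/-- An element which is minimal or whose height is a successor ordinal. -/
def IsMinOrSucc {T : Type u} [PartialOrder T] [IsTree T] (t : T) : Prop :=
  IsMin t ∨ ∃ α : Ordinal.{u}, nodeHeight t = succ α

/-- The topology of `T` is the coarse wedge topology: the one with subbase the sets
`V_t = {s | t ≤ s}` and their complements, `t` being minimal or on a successor level. -/
class CoarseWedgeTopology (T : Type u) [PartialOrder T] [IsTree T] [TopologicalSpace T] :
    Prop where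
  eq_generateFrom : ‹TopologicalSpace T› = TopologicalSpace.generateFrom
    {U | ∃ t : T, IsMinOrSucc t ∧ (U = Ici t ∨ U = (Ici t)ᶜ)}

/-- Every nonempty chain has a supremum. -/
def IsChainComplete (T : Type u) [PartialOrder T] : Prop :=
  ∀ C : Set T, C.Nonempty → IsChain (· ≤ ·) C → ∃ s, IsLUB C s

/-- The Σ-product `Σ(Γ)`: points of `[0,1]^Γ` with countable support. -/
def sigmaProduct (Γ : Type u) : Set (Γ → unitInterval) :=
  {x | {γ | x γ ≠ 0}.Countable}

/-- `A` is a Σ-subset of `K`. -/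
def IsSigmaSubset {K : Type u} [TopologicalSpace K] (A : Set K) : Prop :=
  ∃ (Γ : Type u) (h : K → Γ → unitInterval),
    Topology.IsEmbedding h ∧ h '' A = range h ∩ sigmaProduct Γ

/-- `K` is a Valdivia compact space: a compact Hausdorff space with a dense Σ-subset. -/
def IsValdivia (K : Type u) [TopologicalSpace K] : Prop :=
  CompactSpace K ∧ T2Space K ∧ ∃ A : Set K, Dense A ∧ IsSigmaSubset A

/-- For any two distinct points, some member of the family contains exactly one of them. -/
def IsT0Separating {X : Type u} (𝒰 : Set (Set X)) : Prop :=
  ∀ x y : X, x ≠ y → ∃ U ∈ 𝒰, ({x, y} ∩ U).ncard = 1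

/-- The elements `t` of a tree whose height has countable cofinality, `cf(t) ≤ ω`. -/
def countableCofinality (T : Type u) [PartialOrder T] [IsTree T] : Set T :=
  {t | (nodeHeight t).cof ≤ ℵ₀}

end OrderTree

/-!
Write `V_t` for the wedge `{s | t ≤ s}`. Minimal nodes and nodes on successor levels have
clopen wedges, and they are compact elements of the order: such a `t` lies below the
supremum of a chain only if it lies below a member (`IsMinOrSucc.exists_le_of_le_isLUB`). Hence
suprema of chains are topological limits, and an ultrafilter converges to the supremum of the chain
of those `t` whose wedge it contains (`compactSpace`).

If all heights are at most `ω₁`, the wedges are the required clopen family: they separate points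
because each node is determined by the minimal and successor nodes below it
(`isT0Separating_wedges`), a node lies in countably many wedges exactly when its height is less than
`ω₁` (`countable_wedges_iff`), and a node of height `ω₁` is the limit of its predecessors
(`dense_countableCofinality`). The indicator functions of the wedges embed the tree into a cube
(`isSigmaSubset_of_isT0Separating`).

Conversely, let `h` embed the tree into a cube with a dense set going into the Σ-product, and let
`x` have height `ω₂`. A dense Σ-subset meets the open set `V_u \ V_v` for all successor nodes `u <
v`, so it contains suprema of increasing sequences of successor nodes (`tendsto_of_mem_wedge_diff`,
`mem_sigmaProduct_of_isLUB`); therefore it is cofinal below `x`. Each coordinate of `h` is constant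
on a final segment below `x` (`exists_forall_eq_of_continuous`), and since `cf(x) > ℵ₁` this holds
for `ℵ₁` coordinates at once. So the support of `h x` is countable: otherwise some point of the
Σ-subset below `x` would have uncountable support. Now choose an increasing sequence of points of
the Σ-subset below `x`, each agreeing with `x` on the supports of `h x` and of its predecessor in
the sequence. Their supremum is strictly below `x` and has the same image as `x`, a contradiction
(`cof_le_aleph_one`).
-/

namespace OrderTree

theorem countable_image_iff {α β : Type*} {f : α → β} (hf : Function.Injective f) {s : Set α} :
    (f '' s).Countable ↔ s.Countable :=
  ⟨countable_of_injective_of_countable_image hf.injOn, fun h => h.image f⟩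

section Order

/-! ### Heights and predecessors in trees -/

variable {T : Type u} [PartialOrder T] [IsTree T] {x y t : T}

theorem le_or_le_of_lt (hx : x < t) (hy : y < t) : x ≤ y ∨ y ≤ x := by
  rcases trichotomous_of (fun a b : Iio t => a < b) ⟨x, hx⟩ ⟨y, hy⟩ with h | h | h
  · exact Or.inl (le_of_lt h)
  · exact Or.inl (le_of_eq (congrArg Subtype.val h))
  · exact Or.inr (le_of_lt h)

theorem le_or_le_of_le (hx : x ≤ t) (hy : y ≤ t) : x ≤ y ∨ y ≤ x := by
  rcases hx.eq_or_lt with rfl | hx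
  · exact Or.inr hy
  rcases hy.eq_or_lt with rfl | hy
  · exact Or.inl hx.le
  exact le_or_le_of_lt hx hy

theorem lt_or_le_of_le (hx : x ≤ t) (hy : y ≤ t) : x < y ∨ y ≤ x := by
  rcases le_or_le_of_le hx hy with h | h
  · exact h.lt_or_eq.imp id fun h => h.ge
  · exact Or.inr h

theorem isChain_of_upperBound {C : Set T} (h : ∀ c ∈ C, c ≤ t) : IsChain (· ≤ ·) C :=
  fun a ha b hb _ => le_or_le_of_le (h a ha) (h b hb)

instance (x : T) : WellFoundedLT (Iio x) := ⟨(IsTree.isWellOrder_Iio x).wf⟩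

theorem typein_Iio (y : Iio x) :
    Ordinal.typein (fun a b : Iio x => a < b) y = nodeHeight (y : T) := by
  rw [← Ordinal.type_subrel]
  refine RelIso.ordinalType_congr
    ⟨⟨fun a => ⟨a.1.1, a.2⟩, fun b => ⟨⟨b.1, lt_trans b.2 y.2⟩, b.2⟩,
      fun _ => rfl, fun _ => rfl⟩, Iff.rfl⟩

theorem nodeHeight_strictMono : StrictMono (nodeHeight : T → Ordinal.{u}) := fun y x h => by
  rw [← typein_Iio ⟨y, h⟩]
  exact Ordinal.typein_lt_type _ _

theorem exists_lt_nodeHeight_eq {α : Ordinal.{u}} (h : α < nodeHeight x) :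
    ∃ y < x, nodeHeight y = α := by
  obtain ⟨y, rfl⟩ := Ordinal.typein_surj _ h
  exact ⟨y, y.2, (typein_Iio y).symm⟩

theorem nodeHeight_lt_treeHeight (x : T) : nodeHeight x < treeHeight T := by
  by_contra! h
  obtain ⟨y, hy⟩ : (level T (treeHeight T)).Nonempty := by
    rcases h.eq_or_lt with h | h
    · exact ⟨x, h.symm⟩
    · obtain ⟨y, -, hy⟩ := exists_lt_nodeHeight_eq h
      exact ⟨y, hy⟩
  rw [level_treeHeight] at hy
  exact hy

theorem exists_nodeHeight_eq {α : Ordinal.{u}} (h : α < treeHeight T) :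
    ∃ x : T, nodeHeight x = α :=
  nonempty_iff_ne_empty.2 fun he => notMem_of_lt_csInf' h he

theorem card_nodeHeight (x : T) : (nodeHeight x).card = #(Iio x) := Ordinal.card_type _

theorem exists_isMin_le (x : T) : ∃ m ≤ x, IsMin m := by
  by_cases hx : IsMin x
  · exact ⟨x, le_rfl, hx⟩
  have : (univ : Set (Iio x)).Nonempty := by
    obtain ⟨y, hy⟩ := not_isMin_iff.1 hx
    exact ⟨⟨y, hy⟩, trivial⟩
  obtain ⟨m, -, hm⟩ := wellFounded_lt.has_min univ this
  refine ⟨m, m.2.le, fun b hb => ?_⟩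
  by_contra h
  exact hm ⟨b, hb.trans_lt m.2⟩ trivial (lt_of_le_not_ge hb h)

/-- An element whose greatest strict predecessor is `x` is on the next level. -/
theorem nodeHeight_eq_succ (h : x < y) (h' : ∀ z < y, z ≤ x) :
    nodeHeight y = succ (nodeHeight x) := by
  refine le_antisymm (le_of_forall_lt fun α hα => ?_) (succ_le_of_lt (nodeHeight_strictMono h))
  obtain ⟨z, hz, rfl⟩ := exists_lt_nodeHeight_eq hα
  exact lt_succ_of_le (nodeHeight_strictMono.monotone (h' z hz))

theorem exists_pred {α : Ordinal.{u}} (h : nodeHeight t = succ α) : ∃ p < t, ∀ z < t, z ≤ p := by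
  obtain ⟨p, hp, rfl⟩ := exists_lt_nodeHeight_eq (h.symm ▸ lt_succ α)
  refine ⟨p, hp, fun z hz => ?_⟩
  by_contra hzp
  have hlt : p < z := (lt_or_le_of_le hp.le hz.le).resolve_right hzp
  have := nodeHeight_strictMono hz
  rw [h, lt_succ_iff] at this
  exact this.not_gt (nodeHeight_strictMono hlt)

/-! ### Minimal and successor nodes in chain complete trees -/

/-- A node that is minimal or on a successor level is compact: it lies below the supremum of a
nonempty chain only if it lies below some member of that chain. -/
theorem IsMinOrSucc.exists_le_of_le_isLUB {C : Set T} {s : T} (ht : IsMinOrSucc t)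
    (hC : C.Nonempty) (hs : IsLUB C s) (hts : t ≤ s) : ∃ c ∈ C, t ≤ c := by
  by_contra! h
  have hlt : ∀ c ∈ C, c < t := fun c hc =>
    (lt_or_le_of_le (hs.1 hc) hts).resolve_right (h c hc)
  rcases ht with ht | ⟨α, hα⟩
  · obtain ⟨c, hc⟩ := hC
    exact ht.not_lt (hlt c hc)
  · obtain ⟨p, hp, hp'⟩ := exists_pred hα
    exact ((hts.trans (hs.2 fun c hc => hp' c (hlt c hc))).trans_lt hp).false

theorem isLUB_Iio (hcc : IsChainComplete T) (hx : ¬IsMinOrSucc x) : IsLUB (Iio x) x := by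
  rw [IsMinOrSucc, not_or, not_isMin_iff] at hx
  obtain ⟨s, hs⟩ := hcc (Iio x) hx.1 (isChain_of_upperBound fun c hc => le_of_lt hc)
  rcases (hs.2 fun c hc => le_of_lt hc : s ≤ x).eq_or_lt with rfl | h
  · exact hs
  · exact (hx.2 ⟨_, nodeHeight_eq_succ h fun z hz => hs.1 hz⟩).elim

/-- The least node above `p` on the way to `x` is on a successor level. -/
theorem exists_isMinOrSucc_between {p : T} (hp : p < x) : ∃ u, IsMinOrSucc u ∧ p < u ∧ u ≤ x := by
  have key : ∀ u ≤ x, p < u → (∀ z < u, ¬p < z) → IsMinOrSucc u := fun u hux hpu hu =>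
    Or.inr ⟨_, nodeHeight_eq_succ hpu fun z hz =>
      (lt_or_le_of_le hpu.le hz.le).resolve_left (hu z hz)⟩
  rcases eq_empty_or_nonempty {q : Iio x | p < q} with he | hne
  · exact ⟨x, key x le_rfl hp fun z hz hpz => eq_empty_iff_forall_notMem.1 he ⟨z, hz⟩ hpz,
      hp, le_rfl⟩
  · obtain ⟨q, hq, hmin⟩ := wellFounded_lt.has_min _ hne
    exact ⟨q, key q q.2.le hq fun z hz hpz => hmin ⟨z, hz.trans q.2⟩ hpz hz, hq, q.2.le⟩

/-- In a chain complete tree, a node is determined by the minimal and successor nodes below it. -/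
theorem le_of_forall_isMinOrSucc (hcc : IsChainComplete T)
    (h : ∀ t, IsMinOrSucc t → t ≤ x → t ≤ y) : x ≤ y := by
  by_cases hx : IsMinOrSucc x
  · exact h x hx le_rfl
  refine (isLUB_Iio hcc hx).2 fun p hp => ?_
  obtain ⟨u, hu, hpu, hux⟩ := exists_isMinOrSucc_between hp
  exact hpu.le.trans (h u hu hux)

/-! ### Nodes of uncountable cofinality -/

/-- Fewer than `cf(x)` strict predecessors of `x` have a common strict upper bound below `x`. -/
theorem exists_lt_forall_lt {B : Set T} (hB : ∀ b ∈ B, b < x) (hc : #B < (nodeHeight x).cof) :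
    ∃ p < x, ∀ b ∈ B, b < p := by
  have hsup := Ordinal.iSup_add_one_lt_of_lt_cof (f := fun b : B => nodeHeight b.1) hc
    fun b => nodeHeight_strictMono (hB b b.2)
  obtain ⟨p, hp, hpe⟩ := exists_lt_nodeHeight_eq hsup
  refine ⟨p, hp, fun b hb => ?_⟩
  refine (lt_or_le_of_le (hB b hb).le hp.le).resolve_right fun hle => ?_
  have h1 := nodeHeight_strictMono.monotone hle
  rw [hpe] at h1
  exact (Ordinal.lt_iSup_add_one (f := fun b : B => nodeHeight b.1) ⟨b, hb⟩).not_ge h1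

theorem nonempty_Iio_of_cof (hx : ℵ₀ < (nodeHeight x).cof) : Nonempty (Iio x) := by
  obtain ⟨p, hp, -⟩ := exists_lt_forall_lt (x := x) (B := ∅) (by simp)
    (by simpa using Cardinal.aleph0_pos.trans hx)
  exact ⟨⟨p, hp⟩⟩

theorem not_isMinOrSucc (hx : ℵ₀ < (nodeHeight x).cof) : ¬IsMinOrSucc x := by
  rintro (h | ⟨α, hα⟩)
  · obtain ⟨p⟩ := nonempty_Iio_of_cof hx
    exact h.not_lt p.2
  · rw [hα, Order.succ_eq_add_one, Ordinal.cof_add_one] at hx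
    exact hx.not_gt Cardinal.one_lt_aleph0

theorem exists_isMinOrSucc_between_lt (hx : ℵ₀ < (nodeHeight x).cof) {p : T} (hp : p < x) :
    ∃ u, IsMinOrSucc u ∧ p < u ∧ u < x := by
  obtain ⟨u, hu, hpu, hux⟩ := exists_isMinOrSucc_between hp
  exact ⟨u, hu, hpu, hux.lt_of_ne (by rintro rfl; exact not_isMinOrSucc hx hu)⟩

theorem exists_isLUB_lt (hcc : IsChainComplete T) (hx : ℵ₀ < (nodeHeight x).cof) {u : ℕ → T}
    (hu : ∀ n, u n < x) : ∃ s < x, IsLUB (range u) s := by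
  obtain ⟨p, hp, hup⟩ := exists_lt_forall_lt (x := x) (B := range u) (by simpa)
    ((Cardinal.le_aleph0_iff_set_countable.2 (countable_range u)).trans_lt hx)
  obtain ⟨s, hs⟩ := hcc (range u) (range_nonempty u)
    (isChain_of_upperBound (t := p) fun c hc => (hup c hc).le)
  exact ⟨s, (hs.2 fun c hc => (hup c hc).le).trans_lt hp, hs⟩

theorem directed_Iio (x : T) : IsDirectedOrder (Iio x) :=
  ⟨fun a b => (le_or_le_of_lt a.2 b.2).elim (fun h => ⟨b, h, le_rfl⟩) fun h => ⟨a, le_rfl, h⟩⟩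

/-! ### The family of wedges -/

/-- The family of all wedges `V_t` with `t` minimal or on a successor level. -/
def wedges (T : Type u) [PartialOrder T] [IsTree T] : Set (Set T) :=
  {U | ∃ t, IsMinOrSucc t ∧ U = Ici t}

theorem isT0Separating_wedges (hcc : IsChainComplete T) : IsT0Separating (wedges T) := by
  intro x y hxy
  by_contra! H
  refine hxy (le_antisymm ?_ ?_) <;> refine le_of_forall_isMinOrSucc hcc fun t ht h => ?_ <;>
    by_contra hn <;> refine H (Ici t) ⟨t, ht, rfl⟩ ?_
  · rw [show ({x, y} ∩ Ici t : Set T) = {x} by grind, ncard_singleton]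
  · rw [show ({x, y} ∩ Ici t : Set T) = {y} by grind, ncard_singleton]

theorem cof_omega_one : (ω₁ : Ordinal.{u}).cof = ℵ₁ := by
  rw [← Cardinal.ord_aleph, Cardinal.isRegular_aleph_one.cof_ord]

theorem cof_omega_two : (ω_ 2 : Ordinal.{u}).cof = ℵ_ 2 := by
  rw [← Cardinal.ord_aleph, ← one_add_one_eq_two, (Cardinal.isRegular_aleph_add_one 1).cof_ord]

theorem card_le_aleph0 {α : Ordinal.{u}} (h : α < ω₁) : α.card ≤ ℵ₀ := by
  rwa [Cardinal.card_le_iff, Cardinal.succ_aleph0, Cardinal.ord_aleph]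

theorem mem_countableCofinality_iff (h : nodeHeight x ≤ ω₁) :
    x ∈ countableCofinality T ↔ nodeHeight x < ω₁ := by
  refine ⟨fun hx => h.lt_of_ne fun he => ?_, fun hx =>
    (Ordinal.cof_le_card _).trans (card_le_aleph0 hx)⟩
  rw [countableCofinality, mem_ofPred_eq, he, cof_omega_one] at hx
  exact hx.not_gt Cardinal.aleph0_lt_aleph_one

theorem countable_wedges_iff (h : nodeHeight x ≤ ω₁) :
    {U ∈ wedges T | x ∈ U}.Countable ↔ x ∈ countableCofinality T := by
  have himage : {U ∈ wedges T | x ∈ U} = Ici '' {t | IsMinOrSucc t ∧ t ≤ x} := by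
    ext U
    constructor
    · rintro ⟨⟨t, ht, rfl⟩, hx⟩
      exact ⟨t, ⟨ht, hx⟩, rfl⟩
    · rintro ⟨t, ⟨ht, hx⟩, rfl⟩
      exact ⟨⟨t, ht, rfl⟩, hx⟩
  rw [himage, countable_image_iff Ici_injective]
  constructor
  · intro hc
    by_contra! hx
    replace hx : ℵ₀ < (nodeHeight x).cof := not_le.1 hx
    obtain ⟨p, hp, hlt⟩ := exists_lt_forall_lt (x := x) (B := {t | IsMinOrSucc t ∧ t ≤ x})
      (fun t ht => ht.2.lt_of_ne (by rintro rfl; exact not_isMinOrSucc hx ht.1))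
      ((Cardinal.le_aleph0_iff_set_countable.2 hc).trans_lt hx)
    obtain ⟨u, hu, hpu, hux⟩ := exists_isMinOrSucc_between_lt hx hp
    exact hpu.not_gt (hlt u ⟨hu, hux.le⟩)
  · intro hx
    have hI : (Iio x).Countable := by
      rw [← Cardinal.le_aleph0_iff_set_countable, ← card_nodeHeight]
      exact card_le_aleph0 ((mem_countableCofinality_iff h).1 hx)
    refine (hI.insert x).mono fun t ht => ?_
    exact ht.2.eq_or_lt.imp id id

end Order

section Topology

open Filter Topology

/-! ### Compactness and the Σ-subset given by the wedges -/

/-- A family of clopen sets that separates points embeds a compact space into a cube by indicator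
functions, and a point goes into the Σ-product when it lies in countably many members. -/
theorem isSigmaSubset_of_isT0Separating {K : Type u} [TopologicalSpace K] [CompactSpace K]
    {𝒰 : Set (Set K)} (ho : ∀ U ∈ 𝒰, IsClopen U) (hs : IsT0Separating 𝒰) :
    IsSigmaSubset {x | {U ∈ 𝒰 | x ∈ U}.Countable} := by
  classical
  let h : K → 𝒰 → unitInterval := fun x U => (U : Set K).indicator 1 x
  have hsupp : ∀ x, h x ∈ sigmaProduct 𝒰 ↔ {U ∈ 𝒰 | x ∈ U}.Countable := fun x => by
    rw [show {U ∈ 𝒰 | x ∈ U} = Subtype.val '' {U : 𝒰 | h x U ≠ 0} by ext U; simp [h, and_comm],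
      countable_image_iff Subtype.val_injective]
    rfl
  refine ⟨𝒰, h, ?_, ?_⟩
  · refine (Continuous.isClosedEmbedding (continuous_pi fun U => ?_) ?_).isEmbedding
    · exact continuous_one.indicator fun a ha => by simp [(ho U U.2).frontier_eq] at ha
    · intro x y hxy
      by_contra hne
      obtain ⟨U, hU, hc⟩ := hs x y hne
      have hiff : x ∈ U ↔ y ∈ U := by
        have := congrFun hxy ⟨U, hU⟩
        by_cases hx : x ∈ U <;> by_cases hy : y ∈ U <;> simp_all [h]
      by_cases hx : x ∈ U
      · rw [inter_eq_left.2 (by rintro z (rfl | rfl); exacts [hx, hiff.1 hx]),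
          ncard_pair hne] at hc
        omega
      · rw [show ({x, y} ∩ U : Set K) = ∅ by grind, ncard_empty] at hc
        omega
  · ext z
    constructor
    · rintro ⟨x, hx, rfl⟩
      exact ⟨mem_range_self x, (hsupp x).2 hx⟩
    · rintro ⟨⟨x, rfl⟩, hx⟩
      exact ⟨x, (hsupp x).1 hx, rfl⟩

variable {T : Type u} [PartialOrder T] [IsTree T] [TopologicalSpace T] [CoarseWedgeTopology T]
  {x t : T}

theorem tendsto_nhds_iff {ι : Type*} {f : ι → T} {l : Filter ι} :
    Tendsto f l (𝓝 x) ↔ ∀ t, IsMinOrSucc t →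
      (t ≤ x → ∀ᶠ i in l, t ≤ f i) ∧ (¬t ≤ x → ∀ᶠ i in l, ¬t ≤ f i) := by
  have h := CoarseWedgeTopology.eq_generateFrom (T := T)
  rw [h, TopologicalSpace.tendsto_nhds_generateFrom_iff]
  constructor
  · intro H t ht
    exact ⟨fun hx => H (Ici t) ⟨t, ht, Or.inl rfl⟩ hx, fun hx => H (Ici t)ᶜ ⟨t, ht, Or.inr rfl⟩ hx⟩
  · rintro H _ ⟨t, ht, rfl | rfl⟩ hx
    · exact (H t ht).1 hx
    · exact (H t ht).2 hx

theorem IsMinOrSucc.isClopen_Ici (ht : IsMinOrSucc t) : IsClopen (Ici t) := by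
  have h := CoarseWedgeTopology.eq_generateFrom (T := T)
  constructor
  · rw [← isOpen_compl_iff, h]
    exact .basic _ ⟨t, ht, Or.inr rfl⟩
  · rw [h]
    exact .basic _ ⟨t, ht, Or.inl rfl⟩

/-- A set with a least upper bound in a tree is a chain, and it converges to that bound because
minimal and successor nodes are compact elements. -/
instance : SupConvergenceClass T where
  tendsto_coe_atTop_isLUB s C hs := by
    refine tendsto_nhds_iff.2 fun t ht => ⟨fun hts => ?_, fun hts => ?_⟩
    · rcases isEmpty_or_nonempty C with hC | hC
      · exact .of_forall fun c => hC.elim c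
      obtain ⟨c, hc, htc⟩ := ht.exists_le_of_le_isLUB (nonempty_coe_sort.1 hC) hs hts
      filter_upwards [eventually_ge_atTop (⟨c, hc⟩ : C)] with d hd
      exact htc.trans hd
    · exact .of_forall fun c h => hts (h.trans (hs.1 c.2))

/-- An ultrafilter converges to the supremum of the chain of those minimal or successor nodes whose
wedge it contains; this chain is nonempty because there are finitely many minimal nodes. -/
theorem compactSpace (hcc : IsChainComplete T) (hmin : {t : T | IsMin t}.Finite) :
    CompactSpace T := by
  refine ⟨isCompact_iff_ultrafilter_le_nhds.2 fun F _ => ?_⟩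
  set C : Set T := {t | IsMinOrSucc t ∧ Ici t ∈ F} with hC
  have hne : C.Nonempty := by
    have huniv : ⋃ m ∈ {t : T | IsMin t}, Ici m ∈ F := by
      refine univ_mem' fun x => ?_
      obtain ⟨m, hm, hm'⟩ := exists_isMin_le x
      exact mem_biUnion hm' hm
    obtain ⟨m, hm, hmF⟩ := (Ultrafilter.finite_biUnion_mem_iff hmin).1 huniv
    exact ⟨m, Or.inl hm, hmF⟩
  have hchain : IsChain (· ≤ ·) C := fun a ha b hb _ => by
    obtain ⟨z, hza, hzb⟩ := F.nonempty_of_mem (inter_mem ha.2 hb.2)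
    exact le_or_le_of_le hza hzb
  obtain ⟨s, hs⟩ := hcc C hne hchain
  refine ⟨s, mem_univ _, tendsto_id'.1 (tendsto_nhds_iff.2 fun t ht => ⟨fun h => ?_, fun h => ?_⟩)⟩
  · obtain ⟨c, hc, htc⟩ := ht.exists_le_of_le_isLUB hne hs h
    exact mem_of_superset hc.2 (Ici_subset_Ici.2 htc)
  · exact Ultrafilter.compl_mem_iff_notMem.2 fun hF => h (hs.1 ⟨ht, hF⟩)

theorem t2Space (hcc : IsChainComplete T) : T2Space T := by
  refine t2_iff_ultrafilter.2 fun {x y} F hx hy => ?_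
  have key : ∀ {x y : T}, ↑F ≤ 𝓝 x → ↑F ≤ 𝓝 y → x ≤ y := fun {x y} hx hy => by
    refine le_of_forall_isMinOrSucc hcc fun t ht h => ?_
    by_contra hn
    exact Ultrafilter.compl_mem_iff_notMem.1
      (((tendsto_nhds_iff (f := id)).1 hy t ht).2 hn)
      (((tendsto_nhds_iff (f := id)).1 hx t ht).1 h)
  exact le_antisymm (key hx hy) (key hy hx)

theorem tendsto_coe_Iio (hcc : IsChainComplete T) (hx : ℵ₀ < (nodeHeight x).cof) :
    Tendsto ((↑) : Iio x → T) atTop (𝓝 x) :=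
  SupConvergenceClass.tendsto_coe_atTop_isLUB _ _ (isLUB_Iio hcc (not_isMinOrSucc hx))

theorem dense_countableCofinality (hcc : IsChainComplete T) (h : ∀ x : T, nodeHeight x ≤ ω₁) :
    Dense (countableCofinality T) := by
  intro x
  by_cases hx : (nodeHeight x).cof ≤ ℵ₀
  · exact subset_closure hx
  rw [not_le] at hx
  have := directed_Iio x
  have := nonempty_Iio_of_cof hx
  refine mem_closure_of_tendsto (tendsto_coe_Iio hcc hx) (.of_forall fun p => ?_)
  exact (mem_countableCofinality_iff (h p)).2 ((nodeHeight_strictMono p.2).trans_le (h x))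

/-! ### Height bound for Valdivia trees -/

/-- Points chosen in the successive differences of a decreasing sequence of wedges converge to the
supremum of the nodes defining the wedges, even when they do not lie on the branch of these nodes:
a wedge not containing that supremum contains at most one of them. -/
theorem tendsto_of_mem_wedge_diff {u a : ℕ → T} {s : T} (hu : Monotone u)
    (hs : IsLUB (range u) s) (ha : ∀ n, u n ≤ a n) (ha' : ∀ n, ¬u (n + 1) ≤ a n) :
    Tendsto a atTop (𝓝 s) := by
  refine tendsto_nhds_iff.2 fun t ht => ⟨fun hts => ?_, fun hts => ?_⟩
  · obtain ⟨_, ⟨n, rfl⟩, hn⟩ := ht.exists_le_of_le_isLUB (range_nonempty u) hs hts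
    filter_upwards [eventually_ge_atTop n] with m hm
    exact hn.trans ((hu hm).trans (ha m))
  · by_cases h : ∃ n, t ≤ a n
    · obtain ⟨n, hn⟩ := h
      filter_upwards [eventually_gt_atTop n] with m hm htm
      rcases le_or_le_of_le htm ((hu (succ_le_of_lt hm)).trans (ha m)) with h | h
      · exact hts (h.trans (hs.1 (mem_range_self _)))
      · exact ha' n (h.trans hn)
    · exact .of_forall fun m hm => h ⟨m, hm⟩

/-- A continuous function on the tree is constant on a final segment of the predecessors of a node
of uncountable cofinality. -/
theorem exists_forall_eq_of_continuous {M : Type*} [MetricSpace M] {g : T → M}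
    (hg : Continuous g) (hcc : IsChainComplete T) (hx : ℵ₀ < (nodeHeight x).cof) :
    ∃ b < x, ∀ p, b < p → p < x → g p = g x := by
  have := directed_Iio x
  have := nonempty_Iio_of_cof hx
  have hev : ∀ n : ℕ, ∃ b : Iio x, ∀ p, b ≤ p → dist (g p) (g x) < 1 / (n + 1 : ℝ) := fun n =>
    eventually_atTop.1 <| (hg.continuousAt.tendsto.comp (tendsto_coe_Iio hcc hx)).eventually
      (Metric.ball_mem_nhds _ Nat.one_div_pos_of_nat)
  choose b hb using hev
  obtain ⟨q, hq, hbq⟩ := exists_lt_forall_lt (x := x) (B := range fun n => (b n : T))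
    (by rintro _ ⟨n, rfl⟩; exact (b n).2)
    ((Cardinal.le_aleph0_iff_set_countable.2 (countable_range _)).trans_lt hx)
  refine ⟨q, hq, fun p hqp hpx => ?_⟩
  by_contra hne
  obtain ⟨n, hn⟩ := exists_nat_one_div_lt (dist_pos.2 hne)
  exact hn.not_gt (hb n ⟨p, hpx⟩ ((hbq _ ⟨n, rfl⟩).le.trans hqp.le))

/-- If `h` maps a dense set into the Σ-product, it maps there the supremum of every strictly
increasing sequence of minimal or successor nodes. The nodes themselves need not be mapped there. -/
theorem mem_sigmaProduct_of_isLUB {Γ : Type u} {h : T → Γ → unitInterval} (hh : Continuous h)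
    (hd : Dense (h ⁻¹' sigmaProduct Γ)) {u : ℕ → T} {s : T} (hu : StrictMono u)
    (hu' : ∀ n, IsMinOrSucc (u n)) (hs : IsLUB (range u) s) : h s ∈ sigmaProduct Γ := by
  have hex : ∀ n, ∃ a, a ∈ Ici (u n) ∩ (Ici (u (n + 1)))ᶜ ∧ h a ∈ sigmaProduct Γ := fun n => by
    obtain ⟨a, ha, ha'⟩ := hd.inter_open_nonempty (Ici (u n) ∩ (Ici (u (n + 1)))ᶜ)
      ((hu' n).isClopen_Ici.isOpen.inter (hu' (n + 1)).isClopen_Ici.compl.isOpen)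
      ⟨u n, le_rfl, (hu n.lt_succ_self).not_ge⟩
    exact ⟨a, ha, ha'⟩
  choose a ha haS using hex
  have hlim := tendsto_of_mem_wedge_diff hu.monotone hs (fun n => (ha n).1) fun n => (ha n).2
  refine (countable_iUnion fun n => haS n).mono fun γ hγ => ?_
  by_contra hn
  simp only [mem_iUnion, not_exists, mem_ofPred_eq, not_not] at hn
  refine hγ (tendsto_nhds_unique
    (((continuous_apply γ).comp hh).continuousAt.tendsto.comp hlim) ?_)
  exact tendsto_const_nhds.congr fun n => (hn n).symm

/-- An injective continuous map of the tree into a cube that sends a dense set into the Σ-product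
forces all cofinalities of nodes to be at most `ℵ₁`. Otherwise, below a node `x` with `cf(x) > ℵ₁`,
any `ℵ₁` coordinates are simultaneously eventually constant, and a closing-off argument produces
`s < x` with the same image as `x`. -/
theorem cof_le_aleph_one (hcc : IsChainComplete T) {Γ : Type u} {h : T → Γ → unitInterval}
    (hh : Continuous h) (hinj : Function.Injective h) (hd : Dense (h ⁻¹' sigmaProduct Γ)) (x : T) :
    (nodeHeight x).cof ≤ ℵ₁ := by
  by_contra! hx
  have hx0 : ℵ₀ < (nodeHeight x).cof := Cardinal.aleph0_lt_aleph_one.trans hx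
  -- Points mapped into the Σ-product are cofinal below `x`: suprema of increasing sequences.
  have hcofinal : ∀ p < x, ∃ s, h s ∈ sigmaProduct Γ ∧ p < s ∧ s < x := fun p hp => by
    obtain ⟨u₀, hu₀⟩ := exists_isMinOrSucc_between_lt hx0 hp
    have : Nonempty {u // IsMinOrSucc u ∧ p < u ∧ u < x} := ⟨⟨u₀, hu₀⟩⟩
    have : NoMaxOrder {u // IsMinOrSucc u ∧ p < u ∧ u < x} := ⟨fun u => by
      obtain ⟨v, hv, huv, hvx⟩ := exists_isMinOrSucc_between_lt hx0 u.2.2.2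
      exact ⟨⟨v, hv, u.2.2.1.trans huv, hvx⟩, huv⟩⟩
    obtain ⟨u, hu⟩ := Nat.exists_strictMono {u // IsMinOrSucc u ∧ p < u ∧ u < x}
    obtain ⟨s, hsx, hs⟩ := exists_isLUB_lt hcc hx0 (u := fun n => (u n : T)) fun n => (u n).2.2.2
    exact ⟨s, mem_sigmaProduct_of_isLUB hh hd (fun _ _ hmn => hu hmn) (fun n => (u n).2.1) hs,
      (u 0).2.2.1.trans_le (hs.1 ⟨0, rfl⟩), hsx⟩
  have hconst : ∀ Δ : Set Γ, #Δ ≤ ℵ₁ →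
      ∃ b < x, ∀ γ ∈ Δ, ∀ p, b < p → p < x → h p γ = h x γ := fun Δ hΔ => by
    have hc : ∀ γ, ∃ b < x, ∀ p, b < p → p < x → h p γ = h x γ := fun γ =>
      exists_forall_eq_of_continuous ((continuous_apply γ).comp hh) hcc hx0
    choose b hbx hb using hc
    obtain ⟨q, hq, hbq⟩ := exists_lt_forall_lt (x := x) (B := b '' Δ)
      (by rintro _ ⟨γ, -, rfl⟩; exact hbx γ) ((Cardinal.mk_image_le.trans hΔ).trans_lt hx)
    exact ⟨q, hq, fun γ hγ p hqp hpx => hb γ p ((hbq _ ⟨γ, hγ, rfl⟩).trans hqp) hpx⟩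
  -- `ℵ₁` coordinates in the support of `h x` would be in the support of some `h s`, `s < x`.
  have hxS : h x ∈ sigmaProduct Γ := by
    by_contra hn
    have hle : ℵ₁ ≤ #{γ | h x γ ≠ 0} := by
      rw [← Cardinal.succ_aleph0, succ_le_iff, ← not_le, Cardinal.le_aleph0_iff_set_countable]
      exact hn
    obtain ⟨Δ, hΔ, hcard⟩ := Cardinal.le_mk_iff_exists_subset.1 hle
    obtain ⟨b, hb, hbΔ⟩ := hconst Δ hcard.le
    obtain ⟨s, hs, hbs, hsx⟩ := hcofinal b hb
    have hcount : Δ.Countable := hs.mono fun γ hγ => by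
      have h1 := hΔ hγ
      rw [mem_ofPred_eq, ← hbΔ γ hγ s hbs hsx] at h1
      exact h1
    rw [← Cardinal.le_aleph0_iff_set_countable, hcard] at hcount
    exact hcount.not_gt Cardinal.aleph0_lt_aleph_one
  -- The next point agrees with `x` on the supports of `h x` and of the image of the current point.
  have hnext : ∀ p : {p // p < x ∧ h p ∈ sigmaProduct Γ},
      ∃ q : {p // p < x ∧ h p ∈ sigmaProduct Γ}, p.1 < q.1 ∧
        ∀ γ, h x γ ≠ 0 ∨ h p.1 γ ≠ 0 → h q.1 γ = h x γ := fun p => by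
    have hcount : {γ | h x γ ≠ 0 ∨ h p.1 γ ≠ 0}.Countable := hxS.union p.2.2
    obtain ⟨b, hb, hbΔ⟩ := hconst _
      ((Cardinal.le_aleph0_iff_set_countable.2 hcount).trans Cardinal.aleph0_lt_aleph_one.le)
    obtain ⟨c, hc, hbpc⟩ := exists_lt_forall_lt (x := x) (B := {b, p.1})
      (by rintro _ (rfl | rfl); exacts [hb, p.2.1])
      ((Cardinal.le_aleph0_iff_set_countable.2 (by simp)).trans_lt hx0)
    obtain ⟨s, hs, hcs, hsx⟩ := hcofinal c hc
    exact ⟨⟨s, hsx, hs⟩, (hbpc _ (by simp)).trans hcs,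
      fun γ hγ => hbΔ γ hγ s ((hbpc _ (by simp)).trans hcs) hsx⟩
  choose next hlt heq using hnext
  obtain ⟨p₀⟩ := nonempty_Iio_of_cof hx0
  obtain ⟨s₀, hs₀, -, hs₀x⟩ := hcofinal p₀ p₀.2
  let v : ℕ → {p // p < x ∧ h p ∈ sigmaProduct Γ} := fun n => next^[n] ⟨s₀, hs₀x, hs₀⟩
  have hv : ∀ n, v (n + 1) = next (v n) := fun n => Function.iterate_succ_apply' next n _
  have hmono : StrictMono fun n => (v n : T) := strictMono_nat_of_lt_succ fun n => by
    rw [hv]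
    exact hlt _
  obtain ⟨s, hsx, hs⟩ := exists_isLUB_lt hcc hx0 fun n => (v n).2.1
  refine hsx.ne (hinj (funext fun γ => ?_))
  have hlim : Tendsto (fun n => h (v n) γ) atTop (𝓝 (h s γ)) :=
    ((continuous_apply γ).comp hh).continuousAt.tendsto.comp
      (tendsto_atTop_isLUB hmono.monotone hs)
  -- The coordinate `γ` takes the value `h x γ` at `v n` or at `v (n + 1)`, hence in the limit.
  have hfreq : ∃ᶠ n in atTop, h (v n) γ ∈ ({h x γ} : Set unitInterval) := by
    refine frequently_atTop.2 fun n => ?_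
    by_cases hγ : h x γ ≠ 0 ∨ h (v n) γ ≠ 0
    · exact ⟨n + 1, n.le_succ, by rw [hv]; exact heq _ γ hγ⟩
    · push Not at hγ
      exact ⟨n, le_rfl, hγ.2.trans hγ.1.symm⟩
  exact isClosed_singleton.mem_of_frequently_of_tendsto hfreq hlim

end Topology

end OrderTree

theorem theorem4p1 {T : Type u} [PartialOrder T] [OrderTree.IsTree T]
    [TopologicalSpace T] [OrderTree.CoarseWedgeTopology T]
    (hcc : OrderTree.IsChainComplete T) (hmin : {t : T | IsMin t}.Finite) :
    (OrderTree.treeHeight T ≤ ω₁ + 1 →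
      OrderTree.IsValdivia T ∧
      Dense (OrderTree.countableCofinality T) ∧
      ∃ 𝒰 : Set (Set T), (∀ U ∈ 𝒰, IsClopen U) ∧ OrderTree.IsT0Separating 𝒰 ∧
        OrderTree.countableCofinality T = {x | {U ∈ 𝒰 | x ∈ U}.Countable}) ∧
    (OrderTree.IsValdivia T → OrderTree.treeHeight T < ω_ 2 + 1) := by
  open OrderTree in
  constructor
  · intro hT
    have hle : ∀ x : T, nodeHeight x ≤ ω₁ := fun x =>
      lt_succ_iff.1 ((nodeHeight_lt_treeHeight x).trans_le hT)
    have := compactSpace hcc hmin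
    have hclopen : ∀ U ∈ wedges T, IsClopen U := by
      rintro _ ⟨t, ht, rfl⟩
      exact ht.isClopen_Ici
    have hsep := isT0Separating_wedges hcc
    have hD : countableCofinality T = {x | {U ∈ wedges T | x ∈ U}.Countable} :=
      Set.ext fun x => (countable_wedges_iff (hle x)).symm
    have hdense := dense_countableCofinality hcc hle
    refine ⟨⟨this, t2Space hcc, _, hdense, ?_⟩, hdense, wedges T, hclopen, hsep, hD⟩
    rw [hD]
    exact isSigmaSubset_of_isT0Separating hclopen hsep
  · rintro ⟨-, -, A, hA, Γ, h, hh, hAΓ⟩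
    by_contra! hT
    obtain ⟨x, hx⟩ := exists_nodeHeight_eq ((lt_succ (ω_ 2)).trans_le hT)
    have hsub : A ⊆ h ⁻¹' sigmaProduct Γ := fun a ha =>
      (hAΓ.subset (mem_image_of_mem h ha)).2
    have hcof := cof_le_aleph_one hcc hh.continuous hh.injective (hA.mono hsub) x
    rw [hx, cof_omega_two, Cardinal.aleph_le_aleph] at hcof
    exact hcof.not_gt one_lt_two
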